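/- Theorem 3.3. All groups are abelian and, as a standing convention, all groups and cardinals are infinite. Let $p$ be a prime. A $p$-group is an (additively written) abelian group $G$ in which every element has order a power of $p$; it is separable if it has no nonzero element of infinite height, i.e. $\bigcap_{n} p^nG=0$. A subgroup $H$ of $G$ is pure if $nH = nG\cap H$ for every natural number $n$. A separable $p$-group $G$ is purely universal in a cardinal $\lambda$ if $|G|=\lambda$ and every separable $p$-group $H$ with $|H|\le\lambda$ is isomorphic to a pure subgroup of $G$. Let $\lambda$ be a regular cardinal and suppose that there is a cardinal $\mu$ with $\mu^+<\lambda<\mu^{\aleph_0}$. Then, for every prime $p$, there is no purely universal separable $p$-group in $\lambda$. -/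

import Mathlib

open Cardinal

universe u

/-- A subgroup `H` of an abelian group `G` is pure if `nH = nG ∩ H` for every natural number `n`. -/
def IsPureSubgroup {G : Type u} [AddCommGroup G] (H : AddSubgroup G) : Prop :=
  ∀ n : ℕ, H.map (nsmulAddMonoidHom n) = (nsmulAddMonoidHom (α := G) n).range ⊓ H

/-- An (additively written) abelian group is a separable `p`-group if every element has order a
power of `p` and no nonzero element has infinite `p`-height, i.e. `⋂ₙ pⁿG = 0`. -/
structure IsSeparablePGroup (p : ℕ) (G : Type u) [AddCommGroup G] : Prop where
  exists_pow_nsmul_eq_zero : ∀ x : G, ∃ k : ℕ, p ^ k • x = 0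
  eq_zero_of_infinite_height : ∀ x : G, (∀ k : ℕ, ∃ y : G, p ^ k • y = x) → x = 0

/-- `G` is purely universal for the class `K` of abelian groups in the cardinal `κ`: `G` is in `K`,
has cardinality `κ`, and every infinite `H` in `K` of cardinality at most `κ` is isomorphic to a
pure subgroup of `G`. -/
def IsPurelyUniversal (K : (H : Type u) → [AddCommGroup H] → Prop) (κ : Cardinal.{u})
    (G : Type u) [AddCommGroup G] : Prop :=
  K G ∧ #G = κ ∧
    ∀ (H : Type u) [AddCommGroup H], Infinite H → K H → #H ≤ κ →
      ∃ P : AddSubgroup G, IsPureSubgroup P ∧ Nonempty (H ≃+ P)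

/-! Let `G` be purely universal in `κ`, listed injectively by `r` into `κ`. Club guessing, available
because `μ⁺ < κ`, supplies sequences `c i` of length `μ` in `κ`. Along `c i`, each `x` in `G` has a
pattern: for each `n`, the stages at which `x` is congruent modulo `p ^ (n + 1)` to an already
listed element. As `|G| = κ < μ ^ ℵ₀`, some increasing `b i : ℕ → μ` is the pattern of no `x`. A
separable group `H` of size at most `κ` is built with elements `x i` that become approximable modulo
`p ^ (n + 1)` exactly at stage `c i (b i n)` of a filtration of `H`. For a pure embedding of `H`
into `G`, the filtrations of `H` and `G` match on the closure points of some `g`. A guess `c i`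
inside these points gives the image of `x i` the forbidden pattern `b i`. Purity is what transfers
divisibility from `G` back to `H`. -/

/-- Transfinite recursion, where each new value has to be chosen compatibly with the earlier ones. -/
theorem exists_transfinite_sequence {ι T : Type*} [Preorder ι] [WellFoundedLT ι]
    (P : Set T → T → Prop) (h : ∀ (i : ι) (s : Set.Iio i → T), ∃ t, P (Set.range s) t) :
    ∃ s : ι → T, ∀ i, P (s '' Set.Iio i) (s i) := by
  choose F hF using h
  let s : ι → T := (wellFounded_lt (α := ι)).fix fun i r => F i fun k => r k.1 k.2
  refine ⟨s, fun i => ?_⟩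
  have hs : s i = F i fun k => s k.1 := WellFounded.fix_eq _ _ _
  rw [hs, Set.image_eq_range]
  exact hF i _

theorem exists_strict_upper_bound {κ : Cardinal.{u}} (hκ : κ.IsRegular)
    (s : Set κ.ord.ToType) (hs : #s < κ) : ∃ t, ∀ x ∈ s, x < t := by
  by_contra! h
  have hc : IsCofinal s := h
  have h1 := Order.cof_le hc
  rw [Ordinal.cof_toType, hκ.cof_ord] at h1
  exact h1.not_gt hs

theorem exists_forall_lt_of_mk_lt {κ : Cardinal.{u}} (hκ : κ.IsRegular) {ι : Type u}
    (f : ι → κ.ord.ToType) (hι : #ι < κ) : ∃ t, ∀ i, f i < t := by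
  obtain ⟨t, ht⟩ := exists_strict_upper_bound hκ (Set.range f) (mk_range_le.trans_lt hι)
  exact ⟨t, fun i => ht _ ⟨i, rfl⟩⟩

theorem exists_isLUB_of_bddAbove {T : Type*} [LinearOrder T] [WellFoundedLT T] {s : Set T}
    (hs : BddAbove s) : ∃ a, IsLUB s a :=
  ⟨wellFounded_lt.min _ hs, wellFounded_lt.min_mem _ hs,
    fun _ hb => not_lt.1 (wellFounded_lt.not_lt_min _ hb)⟩

theorem mk_Iio_ord_toType_lt {κ : Cardinal.{u}} (a : κ.ord.ToType) : #(Set.Iio a) < κ := by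
  simpa using mk_Iio_lt a (by simp)

theorem mk_Iic_ord_toType_lt {κ : Cardinal.{u}} (hκ : ℵ₀ ≤ κ) (a : κ.ord.ToType) :
    #(Set.Iic a) < κ := by
  rw [← Set.Iio_insert]
  exact (mk_insert_le).trans_lt
    (add_lt_of_lt hκ (mk_Iio_ord_toType_lt a) (one_lt_aleph0.trans_le hκ))

/-! ### Club guessing. -/

/-- The points closed under a function; up to the least point these sets are a base of the club
filter. -/
def closurePoints {T : Type*} [LT T] (g : T → T) : Set T :=
  {a | ∀ b < a, g b < a}

theorem closurePoints_anti {T : Type*} [Preorder T] {g g' : T → T} (h : ∀ b, g b ≤ g' b) :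
    closurePoints g' ⊆ closurePoints g :=
  fun _ ha b hb => (h b).trans_lt (ha b hb)

/-- A ladder at `δ`: a continuous increasing sequence with supremum `δ`. -/
def IsLadder {M T : Type*} [Preorder M] [Preorder T] (δ : T) (f : M → T) : Prop :=
  ∃ q : M → T, StrictMono q ∧ IsLUB (Set.range q) δ ∧ ∀ j, IsLUB (q '' Set.Iio j) (f j)

theorem exists_ladder_meeting_closurePoints {κ ν : Cardinal.{u}} (hκ : κ.IsRegular)
    (hν : ν.IsRegular) (hνκ : ν < κ) (g : κ.ord.ToType → κ.ord.ToType) :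
    ∃ δ : κ.ord.ToType, (∃ f : ν.ord.ToType → κ.ord.ToType, IsLadder δ f) ∧
      ∀ b < δ, ∃ c < δ, b < c ∧ ∀ z ≤ b, g z < c := by
  -- Each new term exceeds all values of `g` up to the earlier terms, so the supremum `δ` is a limit
  -- of closure steps.
  obtain ⟨e, he⟩ := exists_transfinite_sequence (ι := ν.ord.ToType)
    (fun (S : Set κ.ord.ToType) y => ∀ x ∈ S, x < y ∧ ∀ z ≤ x, g z < y) (by
      intro i s
      have hι : #(Set.Iio i) < κ := (mk_Iio_ord_toType_lt i).trans hνκ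
      obtain ⟨t, ht⟩ := exists_forall_lt_of_mk_lt hκ s hι
      obtain ⟨t', ht'⟩ := exists_forall_lt_of_mk_lt hκ (fun z : Set.Iic t => g z)
        (mk_Iic_ord_toType_lt hκ.1 t)
      refine ⟨max t t', ?_⟩
      rintro _ ⟨k, rfl⟩
      exact ⟨lt_max_of_lt_left (ht k),
        fun z hz => lt_max_of_lt_right (ht' ⟨z, hz.trans (ht k).le⟩)⟩)
  have heR : ∀ k i, k < i → e k < e i ∧ ∀ z ≤ e k, g z < e i :=
    fun k i hk => he i _ ⟨k, hk, rfl⟩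
  have hmono : StrictMono e := fun k i hk => (heR k i hk).1
  obtain ⟨t, ht⟩ := exists_forall_lt_of_mk_lt hκ e (by rwa [mk_ord_toType])
  obtain ⟨δ, hδ⟩ := exists_isLUB_of_bddAbove (s := Set.range e)
    ⟨t, by rintro _ ⟨i, rfl⟩; exact (ht i).le⟩
  have hno := Cardinal.noMaxOrder hν.1
  have hlt : ∀ i, e i < δ := fun i => by
    obtain ⟨i', hi'⟩ := exists_gt i
    exact (hmono hi').trans_le (hδ.1 ⟨i', rfl⟩)
  refine ⟨δ, ?_, fun b hb => ?_⟩
  · choose f hf using fun j : ν.ord.ToType => exists_isLUB_of_bddAbove (s := e '' Set.Iio j)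
      ⟨δ, by rintro _ ⟨i, _, rfl⟩; exact (hlt i).le⟩
    exact ⟨f, e, hmono, hδ, hf⟩
  · obtain ⟨_, ⟨i, rfl⟩, hi⟩ := (lt_isLUB_iff hδ).1 hb
    obtain ⟨i', hi'⟩ := exists_gt i
    exact ⟨e i', hlt i', hi.trans (hmono hi'), fun z hz => (heR i i' hi').2 z (hz.trans hi.le)⟩

theorem IsLadder.monotone {M T : Type*} [Preorder M] [Preorder T] {δ : T} {f : M → T}
    (hf : IsLadder δ f) : Monotone f := by
  obtain ⟨q, -, -, hl⟩ := hf
  intro k j hkj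
  exact (hl k).mono (hl j) (Set.image_mono (Set.Iio_subset_Iio hkj))

theorem IsLadder.le {M T : Type*} [Preorder M] [Preorder T] {δ : T} {f : M → T}
    (hf : IsLadder δ f) (j : M) : f j ≤ δ := by
  obtain ⟨q, -, hδ, hl⟩ := hf
  exact (hl j).mono hδ (Set.image_subset_range _ _)

/-- A ladder of uncountable regular length meets the closure points of `g` unboundedly often, as
soon as its supremum is a limit of closure points. -/
theorem IsLadder.exists_mem_closurePoints {κ ν : Cardinal.{u}}
    (hν : ν.IsRegular) (hν0 : ℵ₀ < ν) {g : κ.ord.ToType → κ.ord.ToType}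
    {δ : κ.ord.ToType} {f : ν.ord.ToType → κ.ord.ToType} (hf : IsLadder δ f)
    (hδ : ∀ b < δ, ∃ c < δ, b < c ∧ ∀ z ≤ b, g z < c) (j : ν.ord.ToType) :
    ∃ j', j < j' ∧ f j < f j' ∧ f j' ∈ closurePoints g := by
  obtain ⟨q, hq, hqδ, hl⟩ := hf
  have hno := Cardinal.noMaxOrder hν.1
  have hlt : ∀ i, q i < δ := fun i => by
    obtain ⟨i', hi'⟩ := exists_gt i
    exact (hq hi').trans_le (hqδ.1 ⟨i', rfl⟩)
  have step : ∀ i, ∃ i', i < i' ∧ ∀ z ≤ q i, g z < q i' := by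
    intro i
    obtain ⟨c, hc, hic, hz⟩ := hδ _ (hlt i)
    obtain ⟨_, ⟨i', rfl⟩, hi'⟩ := (lt_isLUB_iff hqδ).1 hc
    exact ⟨i', hq.lt_iff_lt.1 (hic.trans hi'), fun z h => (hz z h).trans hi'⟩
  choose nx hnx hg using step
  -- The supremum of `ω` closure steps is a closure point; it stays below `ν` because `ν` is regular
  -- and uncountable.
  let J : ℕ → ν.ord.ToType := fun n => nx^[n] j
  have hJ : ∀ n, J (n + 1) = nx (J n) := fun n => Function.iterate_succ_apply' _ _ _
  have hJlt : ∀ n, J n < J (n + 1) := fun n => by rw [hJ]; exact hnx _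
  obtain ⟨t, ht⟩ := exists_strict_upper_bound hν (Set.range J)
    ((Set.countable_range J).le_aleph0.trans_lt hν0)
  obtain ⟨j', hj'⟩ := exists_isLUB_of_bddAbove (s := Set.range J) ⟨t, fun x hx => (ht x hx).le⟩
  have hJj : ∀ n, J n < j' := fun n => (hJlt n).trans_le (hj'.1 ⟨n + 1, rfl⟩)
  have hqf : ∀ n, q (J n) ≤ f j' := fun n => (hl j').1 ⟨_, hJj n, rfl⟩
  refine ⟨j', hJj 0, ?_, fun b hb => ?_⟩
  · have h1 : f j ≤ q j := (hl j).2 (by rintro _ ⟨k, hk, rfl⟩; exact (hq hk).le)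
    exact h1.trans_lt ((hq (hJlt 0)).trans_le (hqf 1))
  · obtain ⟨_, ⟨k, hk, rfl⟩, hbk⟩ := (lt_isLUB_iff (hl j')).1 hb
    obtain ⟨_, ⟨n, rfl⟩, hkn⟩ := (lt_isLUB_iff hj').1 hk
    have h2 := hg (J n) b (hbk.le.trans (hq hkn).le)
    rw [← hJ] at h2
    exact h2.trans_le (hqf _)

/-- There is a family of ladders such that closure points of any function contain a whole
subsequence of full length of one of them. -/
theorem exists_ladder_system {κ ν : Cardinal.{u}} (hκ : κ.IsRegular)
    (hν : ν.IsRegular) (hν0 : ℵ₀ < ν) (hνκ : ν < κ) :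
    ∃ f : κ.ord.ToType → ν.ord.ToType → κ.ord.ToType, (∀ δ j, f δ j ≤ δ) ∧
      ∀ g : κ.ord.ToType → κ.ord.ToType, ∃ δ, ∃ s : ν.ord.ToType → ν.ord.ToType,
        StrictMono (f δ ∘ s) ∧ ∀ i, f δ (s i) ∈ closurePoints g := by
  classical
  let f : κ.ord.ToType → ν.ord.ToType → κ.ord.ToType := fun δ =>
    if h : ∃ f : ν.ord.ToType → κ.ord.ToType, IsLadder δ f then h.choose else fun _ => δ
  refine ⟨f, fun δ j => ?_, fun g => ?_⟩
  · by_cases h : ∃ f : ν.ord.ToType → κ.ord.ToType, IsLadder δ f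
    · simp only [f, dif_pos h]; exact h.choose_spec.le j
    · simp only [f, dif_neg h]; exact le_rfl
  · obtain ⟨δ, h, hδ⟩ := exists_ladder_meeting_closurePoints hκ hν hνκ g
    have hf : IsLadder δ (f δ) := by simp only [f, dif_pos h]; exact h.choose_spec
    obtain ⟨s, hs⟩ := exists_transfinite_sequence (ι := ν.ord.ToType)
      (fun (S : Set ν.ord.ToType) j => (∀ k ∈ S, f δ k < f δ j) ∧ f δ j ∈ closurePoints g) (by
        intro i s
        obtain ⟨t, ht⟩ := exists_forall_lt_of_mk_lt hν s (mk_Iio_ord_toType_lt i)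
        obtain ⟨j', -, h2, h3⟩ := hf.exists_mem_closurePoints hν hν0 hδ t
        refine ⟨j', ?_, h3⟩
        rintro _ ⟨k, rfl⟩
        exact (hf.monotone (ht k).le).trans_lt h2)
    exact ⟨δ, s, fun k i hk => (hs i).1 _ ⟨k, hk, rfl⟩, fun i => (hs i).2⟩

/-- Club guessing: there is a family of sequences of order type `μ` in `κ`, with fewer than `κ` of
them attached to each bounded part of `κ`, such that each club contains one of them. -/
theorem exists_club_guessing {κ μ : Cardinal.{u}} (hκ : κ.IsRegular) (hμ : ℵ₀ ≤ μ)
    (hμκ : Order.succ μ < κ) :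
    ∃ (I : Type u) (d : I → κ.ord.ToType) (c : I → μ.ord.ToType → κ.ord.ToType),
      (∀ β, #{i // d i ≤ β} < κ) ∧ (∀ i, StrictMono (c i)) ∧ (∀ i q, c i q ≤ d i) ∧
      ∀ g : κ.ord.ToType → κ.ord.ToType, ∃ i, ∀ q, c i q ∈ closurePoints g := by
  classical
  set ν := Order.succ μ with hνdef
  have hν : ν.IsRegular := isRegular_succ hμ
  have hμν : μ < ν := Order.lt_succ μ
  obtain ⟨f, hfle, hf⟩ := exists_ladder_system hκ hν (hμ.trans_lt hμν) hμκ
  obtain ⟨g₀, hg₀⟩ : ∃ g₀ : κ.ord.ToType → κ.ord.ToType, ∀ g : κ.ord.ToType → κ.ord.ToType,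
      ∃ δ j, (∀ k < j, f δ k ∈ closurePoints g₀ → f δ k ∈ closurePoints g) ∧
        ∃ c : μ.ord.ToType → κ.ord.ToType, StrictMono c ∧
          ∀ q, c q ∈ closurePoints g₀ ∧ ∃ k < j, f δ k = c q := by
    -- Otherwise every `g₀` has a counterexample `N g₀`; iterating this `ν = μ⁺` times thins the
    -- ladders too often.
    by_contra! hcon
    choose N hN using hcon
    have hbound : ∀ {ι : Type u} (s : ι → κ.ord.ToType → κ.ord.ToType), #ι < κ →
        ∃ t : κ.ord.ToType → κ.ord.ToType, ∀ i b, s i b < t b := fun s hι => by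
      choose t ht using fun b => exists_forall_lt_of_mk_lt hκ (fun i => s i b) hι
      exact ⟨t, fun i b => ht b i⟩
    obtain ⟨h, hh⟩ := exists_transfinite_sequence (ι := ν.ord.ToType)
      (fun (S : Set (κ.ord.ToType → κ.ord.ToType)) t => ∀ g ∈ S, ∀ b, N g b ≤ t b) (by
        intro i s
        obtain ⟨t, ht⟩ := hbound (fun k => N (s k)) ((mk_Iio_ord_toType_lt i).trans hμκ)
        refine ⟨t, ?_⟩
        rintro _ ⟨k, rfl⟩ b
        exact (ht k b).le)
    have hh' : ∀ k i, k < i → closurePoints (h i) ⊆ closurePoints (N (h k)) :=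
      fun k i hk => closurePoints_anti (hh i _ ⟨k, hk, rfl⟩)
    obtain ⟨G, hG⟩ := hbound h (by rwa [mk_ord_toType])
    obtain ⟨δ, s, hs, hsG⟩ := hf G
    obtain ⟨e, he⟩ := exists_transfinite_sequence (ι := μ.ord.ToType)
      (fun (S : Set ν.ord.ToType) j => ∀ k ∈ S, k < j) (by
        intro i s
        obtain ⟨t, ht⟩ := exists_forall_lt_of_mk_lt hν s ((mk_Iio_ord_toType_lt i).trans hμν)
        refine ⟨t, ?_⟩
        rintro _ ⟨k, rfl⟩
        exact ht k)
    have hemono : StrictMono e := fun k i hk => he i _ ⟨k, hk, rfl⟩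
    obtain ⟨j, hj⟩ := exists_forall_lt_of_mk_lt hν (s ∘ e) (by rwa [mk_ord_toType])
    -- `r k` is a stage at which the rung `k` is lost, if it ever is. Fewer than `ν` rungs lie below
    -- `j`, so some stage `i` exceeds all these `r k`, and passing from `h i` to `N (h i)` loses no
    -- rung there.
    have hex : ∀ k, ∃ i, f δ k ∈ closurePoints (N (h i)) →
        ∀ i, f δ k ∈ closurePoints (N (h i)) := fun k => by
      by_cases hk : ∃ i, f δ k ∉ closurePoints (N (h i))
      · exact ⟨hk.choose, fun h' => absurd h' hk.choose_spec⟩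
      · push Not at hk
        exact ⟨j, fun _ => hk⟩
    choose r hr using hex
    obtain ⟨i, hi⟩ := exists_forall_lt_of_mk_lt hν (fun k : Set.Iio j => r k)
      (mk_Iio_ord_toType_lt j)
    obtain ⟨q, hq⟩ := hN (h i) δ j
      (fun k hk hmem => hr k (hh' _ _ (hi ⟨k, hk⟩) hmem) i) (f δ ∘ s ∘ e) (hs.comp hemono)
    exact hq (closurePoints_anti (fun b => (hG i b).le) (hsG (e q))) (s (e q)) (hj q) rfl
  let I := {i : κ.ord.ToType × ν.ord.ToType // ∃ c : μ.ord.ToType → κ.ord.ToType, StrictMono c ∧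
          ∀ q, c q ∈ closurePoints g₀ ∧ ∃ k < i.2, f i.1 k = c q}
  refine ⟨I, fun i => i.1.1, fun i => i.2.choose, fun β => ?_, fun i => i.2.choose_spec.1,
    fun i q => ?_, fun g => ?_⟩
  · let F : {i : I // i.1.1 ≤ β} → Set.Iic β × ν.ord.ToType := fun i => (⟨i.1.1.1, i.2⟩, i.1.1.2)
    have hF : Function.Injective F := by
      rintro ⟨⟨⟨a, b⟩, h1⟩, h2⟩ ⟨⟨⟨a', b'⟩, h1'⟩, h2'⟩ h
      simp only [F, Prod.mk.injEq] at h
      obtain ⟨h3, rfl⟩ := h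
      obtain rfl := congrArg Subtype.val h3
      rfl
    refine (mk_le_of_injective hF).trans_lt ?_
    rw [mk_prod, lift_id, lift_id]
    exact mul_lt_of_lt hκ.1 (mk_Iic_ord_toType_lt hκ.1 β) (by rwa [mk_ord_toType])
  · obtain ⟨k, -, hk⟩ := (i.2.choose_spec.2 q).2
    exact hk.ge.trans (hfle _ _)
  · obtain ⟨δ, j, h1, h2⟩ := hg₀ g
    refine ⟨⟨(δ, j), h2⟩, fun q => ?_⟩
    obtain ⟨h3, k, hk, h4⟩ := h2.choose_spec.2 q
    change h2.choose q ∈ _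
    rw [← h4] at h3 ⊢
    exact h1 k hk h3

/-! ### Counting increasing sequences. -/

theorem power_aleph0_le_mk_strictMono {μ : Cardinal.{u}} (hμ : ℵ₀ ≤ μ) :
    μ ^ ℵ₀ ≤ #{a : ℕ → μ.ord.ToType // StrictMono a} := by
  have hinf : Infinite μ.ord.ToType := by rw [infinite_iff, mk_ord_toType]; exact hμ
  -- Every final segment of `μ` still has `μ` elements, so an arbitrary sequence can be coded by the
  -- successive jumps of an increasing one.
  have hθ : ∀ q : μ.ord.ToType, Nonempty (μ.ord.ToType ↪ Set.Ioi q) := fun q => by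
    have h := mk_compl_of_infinite (Set.Iic q)
      (by rw [mk_ord_toType]; exact mk_Iic_ord_toType_lt hμ q)
    rw [Set.compl_Iic] at h
    exact le_def _ _ |>.1 h.ge
  let θ := fun q => (hθ q).some
  let A : (ℕ → μ.ord.ToType) → ℕ → μ.ord.ToType := fun f n =>
    Nat.rec (f 0) (fun k r => (θ r (f (k + 1))).1) n
  have hA : ∀ f n, A f (n + 1) = (θ (A f n) (f (n + 1))).1 := fun _ _ => rfl
  have hmono : ∀ f, StrictMono (A f) := fun f => strictMono_nat_of_lt_succ fun n => by
    rw [hA]; exact (θ (A f n) (f (n + 1))).2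
  have hinj : Function.Injective
      fun f => (⟨A f, hmono f⟩ : {a : ℕ → μ.ord.ToType // StrictMono a}) := by
    intro f f' h
    have h' : A f = A f' := congrArg Subtype.val h
    funext n
    cases n with
    | zero => exact congrFun h' 0
    | succ n =>
      have h1 := congrFun h' (n + 1)
      rw [hA, hA, congrFun h' n] at h1
      exact (θ _).injective (Subtype.ext h1)
  have h := mk_le_of_injective hinj
  simpa using h

theorem IsPureSubgroup.exists_mem_nsmul_eq {G : Type u} [AddCommGroup G] {P : AddSubgroup G}
    (hP : IsPureSubgroup P) {n : ℕ} {u z : G} (hu : u ∈ P) (hz : u = n • z) :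
    ∃ w ∈ P, u = n • w := by
  have h : u ∈ P.map (nsmulAddMonoidHom n) := by
    rw [hP n]
    exact ⟨⟨z, hz.symm⟩, hu⟩
  obtain ⟨w, hw, rfl⟩ := h
  exact ⟨w, hw, rfl⟩

theorem AddSubgroup.mk_closure_le {V : Type u} [AddCommGroup V] (s : Set V) :
    #(AddSubgroup.closure s) ≤ max #s ℵ₀ := by
  have h : (AddSubgroup.closure s : Set V) ⊆
      Set.range (Finsupp.linearCombination ℤ ((↑) : s → V)) := by
    intro v hv
    have hv' : v ∈ AddSubgroup.closure s := hv
    rw [← Submodule.span_int_eq_addSubgroupClosure] at hv'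
    have h1 : v ∈ Submodule.span ℤ (Set.range ((↑) : s → V)) := by simpa using hv'
    rwa [← Finsupp.range_linearCombination] at h1
  refine (mk_le_mk_of_subset h).trans (mk_range_le.trans ?_)
  rcases isEmpty_or_nonempty s with hs | hs
  · exact (lt_aleph0_of_finite _).le.trans (le_max_right _ _)
  · simp

/-! ### The group with prescribed drops. -/

namespace CyclicSum

theorem apply_pow_nsmul (p : ℕ) {T : Type*} (n : ℕ) (t : T)
    (v : (m : ℕ) → T → ZMod (p ^ (m + 1))) : (p ^ (n + 1) • v) n t = 0 := by
  rw [Pi.smul_apply, Pi.smul_apply, nsmul_eq_mul, ZMod.natCast_self, zero_mul]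

variable (p : ℕ) {T : Type u} [LinearOrder T]

/-- The generator of the `γ`-th copy of the cyclic group of order `p ^ (n + 1)` in the product of
all these copies. -/
def gen (n : ℕ) (γ : T) : (m : ℕ) → T → ZMod (p ^ (m + 1)) :=
  fun m t => if m = n ∧ t = γ then 1 else 0

/-- The formal sum `∑ m ≥ k, p ^ (m - k) • gen m (a m)`. -/
def branch (a : ℕ → T) (k : ℕ) : (m : ℕ) → T → ZMod (p ^ (m + 1)) :=
  fun m t => if k ≤ m ∧ t = a m then (p : ZMod (p ^ (m + 1))) ^ (m - k) else 0

theorem pow_nsmul_gen (n : ℕ) (γ : T) : p ^ (n + 1) • gen p n γ = 0 := by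
  funext m t
  simp only [gen, Pi.smul_apply, Pi.zero_apply]
  split_ifs with h
  · obtain ⟨rfl, -⟩ := h
    rw [nsmul_one, ZMod.natCast_self]
  · simp

theorem pow_nsmul_branch (a : ℕ → T) (k : ℕ) : p ^ (k + 1) • branch p a k = 0 := by
  funext m t
  simp only [branch, Pi.smul_apply, Pi.zero_apply]
  split_ifs with h
  · rw [nsmul_eq_mul, Nat.cast_pow, ← pow_add, show k + 1 + (m - k) = m + 1 by omega,
      ← Nat.cast_pow, ZMod.natCast_self]
  · simp

theorem branch_eq (a : ℕ → T) (k : ℕ) :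
    branch p a k = gen p k (a k) + p • branch p a (k + 1) := by
  funext m t
  simp only [branch, gen, Pi.smul_apply, Pi.add_apply]
  rcases lt_trichotomy m k with h | rfl | h
  · simp [h.not_ge, h.ne, show ¬ k + 1 ≤ m by omega]
  · by_cases ht : t = a m <;> simp [ht]
  · by_cases ht : t = a m
    · simp only [h.le, ht, and_self, if_true, h.ne', false_and, if_false, zero_add,
        show k + 1 ≤ m by omega, nsmul_eq_mul]
      rw [← pow_succ', show m - (k + 1) + 1 = m - k by omega]
    · simp [ht, h.ne']

variable {I : Type u} (d : I → T) (a : I → ℕ → T)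

/-- The generators of index at most `β`. -/
def levelGen (β : T) : Set ((m : ℕ) → T → ZMod (p ^ (m + 1))) :=
  Set.range (fun x : ℕ × Set.Iic β => gen p x.1 x.2.1) ∪
    Set.range (fun x : ℕ × {i // d i ≤ β} => branch p (a x.2.1) x.1)

/-- The subgroup spanned by the generators of index at most `β`. -/
def level (β : T) : AddSubgroup ((m : ℕ) → T → ZMod (p ^ (m + 1))) :=
  AddSubgroup.closure (levelGen p d a β)

theorem gen_mem_level (n : ℕ) {γ β : T} (h : γ ≤ β) : gen p n γ ∈ level p d a β :=
  AddSubgroup.subset_closure (Or.inl ⟨(n, ⟨γ, h⟩), rfl⟩)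

theorem branch_mem_level (k : ℕ) {i : I} {β : T} (h : d i ≤ β) :
    branch p (a i) k ∈ level p d a β :=
  AddSubgroup.subset_closure (Or.inr ⟨(k, ⟨i, h⟩), rfl⟩)

theorem level_mono : Monotone (level p d a) := by
  intro β β' h
  refine AddSubgroup.closure_mono ?_
  rintro _ (⟨⟨n, γ⟩, rfl⟩ | ⟨⟨n, i⟩, rfl⟩)
  · exact Or.inl ⟨(n, ⟨γ.1, γ.2.trans h⟩), rfl⟩
  · exact Or.inr ⟨(n, ⟨i.1, i.2.trans h⟩), rfl⟩

variable {d a}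

/-- All supports in a level are bounded by its index; this makes coordinates detect lack of
approximation. -/
theorem apply_eq_zero_of_mem_level (had : ∀ i n, a i n ≤ d i) {β t : T} (ht : β < t)
    {v : (m : ℕ) → T → ZMod (p ^ (m + 1))} (hv : v ∈ level p d a β) (m : ℕ) : v m t = 0 := by
  induction hv using AddSubgroup.closure_induction with
  | mem x hx =>
    rcases hx with ⟨⟨n, γ⟩, rfl⟩ | ⟨⟨n, i⟩, rfl⟩
    · exact if_neg fun h => (γ.2.trans_lt ht).ne' h.2
    · exact if_neg fun h => (((had i m).trans i.2).trans_lt ht).ne' h.2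
  | zero => rfl
  | add x y _ _ hx hy => rw [Pi.add_apply, Pi.add_apply, hx, hy, add_zero]
  | neg x _ hx => rw [Pi.neg_apply, Pi.neg_apply, hx, neg_zero]

theorem exists_pow_nsmul_eq_zero_of_mem_level {β : T}
    {v : (m : ℕ) → T → ZMod (p ^ (m + 1))} (hv : v ∈ level p d a β) : ∃ k : ℕ, p ^ k • v = 0 := by
  induction hv using AddSubgroup.closure_induction with
  | mem x hx =>
    rcases hx with ⟨⟨n, γ⟩, rfl⟩ | ⟨⟨n, i⟩, rfl⟩
    · exact ⟨_, pow_nsmul_gen p n γ.1⟩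
    · exact ⟨_, pow_nsmul_branch p _ n⟩
  | zero => exact ⟨0, smul_zero _⟩
  | add x y _ _ hx hy =>
    obtain ⟨k, hk⟩ := hx
    obtain ⟨l, hl⟩ := hy
    refine ⟨k + l, ?_⟩
    rw [smul_add, pow_add, mul_smul, mul_smul, hl, smul_comm, hk, smul_zero, smul_zero, add_zero]
  | neg x _ hx =>
    obtain ⟨k, hk⟩ := hx
    exact ⟨k, by rw [smul_neg, hk, neg_zero]⟩

/-- By telescoping `branch_eq`, the difference is the partial sum of the terms `p ^ k • gen k (a i
k)` with `k ≤ n`, whose indices are at most `a i n`. -/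
theorem exists_branch_sub_eq (hmono : ∀ i, StrictMono (a i)) (i : I) (n : ℕ) :
    branch p (a i) 0 - p ^ (n + 1) • branch p (a i) (n + 1) ∈ level p d a (a i n) := by
  have key : ∀ k ≤ n + 1, branch p (a i) 0 - p ^ k • branch p (a i) k ∈ level p d a (a i n) := by
    intro k
    induction k with
    | zero => intro _; simp [zero_mem]
    | succ k ih =>
      intro hk
      have h1 := add_mem (ih (by omega)) (nsmul_mem (gen_mem_level p d a k
        ((hmono i).monotone (show k ≤ n by omega))) (p ^ k))
      convert h1 using 1
      conv_rhs => rw [branch_eq p (a i) k]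
      rw [smul_add, pow_succ, mul_smul]
      abel
  exact key _ le_rfl

theorem mk_level_lt {κ : Cardinal.{u}} (hκ : ℵ₀ < κ) {β : T} (hβ : #(Set.Iic β) < κ)
    (hd : #{i // d i ≤ β} < κ) : #(level p d a β) < κ := by
  have h : ∀ {α : Type u}, #α < κ → #(ℕ × α) < κ := fun hα => by
    rw [mk_prod, lift_id', mk_nat, lift_aleph0]
    exact mul_lt_of_lt hκ.le hκ (by simpa using hα)
  refine (AddSubgroup.mk_closure_le _).trans_lt (max_lt ?_ hκ)
  refine (mk_union_le _ _).trans_lt (add_lt_of_lt hκ.le ?_ ?_)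
  · exact mk_range_le.trans_lt (h hβ)
  · exact mk_range_le.trans_lt (h hd)

end CyclicSum

open CyclicSum in
/-- Given increasing sequences `a i` in a regular cardinal, there is a separable `p`-group filtered
by small subsets with elements `x i` whose distance from the filtration drops exactly along
`a i`. -/
theorem exists_isSeparablePGroup_with_drops {p : ℕ} (hp : p.Prime) {κ : Cardinal.{u}}
    (hκ : κ.IsRegular) (hκ0 : ℵ₀ < κ) {I : Type u} {d : I → κ.ord.ToType}
    {a : I → ℕ → κ.ord.ToType} (hd : ∀ β, #{i // d i ≤ β} < κ) (hmono : ∀ i, StrictMono (a i))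
    (had : ∀ i n, a i n ≤ d i) :
    ∃ (H : Type u) (_ : AddCommGroup H) (L : κ.ord.ToType → Set H) (x : I → H),
      Infinite H ∧ IsSeparablePGroup p H ∧ #H ≤ κ ∧ (∀ β, #(L β) < κ) ∧ Monotone L ∧
      (∀ h, ∃ β, h ∈ L β) ∧
      (∀ i n, ∃ y ∈ L (a i n), ∃ z, x i - y = p ^ (n + 1) • z) ∧
      ∀ i n β, β < a i n → ∀ y ∈ L β, ∀ z, x i - y ≠ p ^ (n + 1) • z := by
  have : Nonempty κ.ord.ToType := nonempty_ord_toType hκ.ne_zero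
  have hsup : ∀ v, v ∈ (⨆ β, level p d a β) ↔ ∃ β, v ∈ level p d a β := fun v =>
    AddSubgroup.mem_iSup_of_directed (level_mono p d a).directed_le
  have hle : ∀ β, level p d a β ≤ ⨆ β, level p d a β := le_iSup (level p d a)
  have hlt : ∀ β, #(level p d a β) < κ := fun β =>
    mk_level_lt p hκ0 (mk_Iic_ord_toType_lt hκ.1 β) (hd β)
  refine ⟨(⨆ β, level p d a β : AddSubgroup _), inferInstance,
    fun β => {h | h.1 ∈ level p d a β},
    fun i => ⟨branch p (a i) 0, hle (d i) (branch_mem_level p d a 0 le_rfl)⟩,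
    ?_, ⟨?_, ?_⟩, ?_, ?_, ?_, ?_, ?_, ?_⟩
  · obtain ⟨γ⟩ := this
    refine Infinite.of_injective
      (fun n : ℕ => (⟨gen p n γ, hle γ (gen_mem_level p d a n le_rfl)⟩ :
        (⨆ β, level p d a β : AddSubgroup _))) fun m n h => ?_
    by_contra hmn
    have h1 := congrFun (congrFun (congrArg Subtype.val h) m) γ
    have : Fact (1 < p ^ (m + 1)) := ⟨Nat.one_lt_pow (by omega) hp.one_lt⟩
    simp [gen, hmn] at h1
  · rintro ⟨v, hv⟩
    obtain ⟨β, hβ⟩ := (hsup v).1 hv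
    obtain ⟨k, hk⟩ := exists_pow_nsmul_eq_zero_of_mem_level p hβ
    exact ⟨k, Subtype.ext hk⟩
  · rintro ⟨v, hv⟩ h
    -- The `n`-th factors have exponent `p ^ (n + 1)`, so infinite height kills every coordinate.
    refine Subtype.ext (funext fun n => funext fun t => ?_)
    obtain ⟨y, hy⟩ := h (n + 1)
    have h1 : p ^ (n + 1) • y.1 = v := congrArg Subtype.val hy
    change v n t = 0
    rw [← h1]
    exact apply_pow_nsmul p n t y.1
  · have h1 : SetLike.coe (⨆ β, level p d a β) = ⋃ β, SetLike.coe (level p d a β) := by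
      ext v
      simpa using hsup v
    change #(SetLike.coe (⨆ β, level p d a β)) ≤ κ
    rw [h1]
    refine (mk_iUnion_le _).trans ?_
    refine (mul_le_mul' (mk_ord_toType κ).le (ciSup_le' fun β => (hlt β).le)).trans ?_
    rw [mul_eq_self hκ.1]
  · intro β
    refine lt_of_le_of_lt ?_ (hlt β)
    refine mk_le_of_injective (f := fun h => (⟨h.1.1, h.2⟩ : level p d a β)) fun h h' e => ?_
    exact Subtype.ext (Subtype.ext (Subtype.mk.inj e))
  · exact fun β β' h v hv => level_mono p d a h hv
  · rintro ⟨v, hv⟩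
    exact (hsup v).1 hv
  · intro i n
    have h1 := exists_branch_sub_eq p (d := d) hmono i n
    exact ⟨⟨_, hle _ h1⟩, h1,
      ⟨branch p (a i) (n + 1), hle (d i) (branch_mem_level p d a _ le_rfl)⟩,
      Subtype.ext (sub_sub_cancel _ _)⟩
  · rintro i n β hβ ⟨y, hy'⟩ hy z h
    have h1 : branch p (a i) 0 - y = p ^ (n + 1) • z.1 := congrArg Subtype.val h
    -- At coordinate `(n, a i n)` the branch is `p ^ n`, nonzero modulo `p ^ (n + 1)`, while `y` and
    -- the multiple vanish.
    have h2 := congrFun (congrFun h1 n) (a i n)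
    have h3 : y n (a i n) = 0 := apply_eq_zero_of_mem_level p had hβ hy n
    rw [apply_pow_nsmul, Pi.sub_apply, Pi.sub_apply, h3, sub_zero] at h2
    simp only [branch, zero_le, true_and, if_true, Nat.sub_zero] at h2
    rw [← Nat.cast_pow, ZMod.natCast_eq_zero_iff] at h2
    exact absurd (Nat.le_of_dvd (pow_pos hp.pos _) h2)
      (Nat.pow_lt_pow_right hp.one_lt (Nat.lt_succ_self n)).not_ge

/-! ### Diagonalisation against a universal group. -/

/-- Fewer than `μ ^ ℵ₀` points realise the drops of fewer than `μ ^ ℵ₀` sequences. -/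
theorem exists_strictMono_not_realised {μ : Cardinal.{u}} (hμ : ℵ₀ ≤ μ) {G : Type u}
    (hG : #G < μ ^ ℵ₀) (D : G → ℕ → μ.ord.ToType → Prop) :
    ∃ b : ℕ → μ.ord.ToType, StrictMono b ∧ ∀ x, ¬ ∀ n q, D x n q ↔ b n < q := by
  by_contra! h
  choose f hf using h
  have hinj : Function.Injective
      fun b : {a : ℕ → μ.ord.ToType // StrictMono a} => f b.1 b.2 := by
    intro b b' hbb
    have hbb' : f b.1 b.2 = f b'.1 b'.2 := hbb
    refine Subtype.ext (funext fun n => ?_)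
    have h1 : ∀ q, b.1 n < q ↔ b'.1 n < q := fun q => by
      rw [← hf b.1 b.2, hbb', hf b'.1 b'.2]
    exact eq_of_forall_gt_iff h1
  exact ((power_aleph0_le_mk_strictMono hμ).trans (mk_le_of_injective hinj)).not_gt hG

theorem theorem3p3 (p : ℕ) (hp : p.Prime) (κ : Cardinal.{u}) (hκ : κ.IsRegular)
    (hμ : ∃ μ : Cardinal.{u}, ℵ₀ ≤ μ ∧ Order.succ μ < κ ∧ κ < μ ^ ℵ₀) :
    ¬ ∃ (G : Type u) (_ : AddCommGroup G),
      IsPurelyUniversal (fun H [AddCommGroup H] => IsSeparablePGroup p H) κ G := by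
  rintro ⟨G, _, -, hGκ, huniv⟩
  obtain ⟨μ, hμ0, hμκ, hκμ⟩ := hμ
  have hκ0 : ℵ₀ < κ := hμ0.trans_lt ((Order.lt_succ μ).trans hμκ)
  obtain ⟨r⟩ : Nonempty (G ↪ κ.ord.ToType) := by
    rw [← le_def, mk_ord_toType, hGκ]
  obtain ⟨I, d, c, hd, hc, hcd, hguess⟩ := exists_club_guessing hκ hμ0 hμκ
  choose b hb hbr using fun i => exists_strictMono_not_realised hμ0 (hGκ.trans_lt hκμ)
    fun x n q => ∃ y, r y < c i q ∧ ∃ z, x - y = p ^ (n + 1) • z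
  obtain ⟨H, _, L, x, hinf, hsep, hHκ, hLκ, hLmono, hLtop, hxL, hxL'⟩ :=
    exists_isSeparablePGroup_with_drops hp hκ hκ0 hd (fun i => (hc i).comp (hb i))
      fun i n => hcd i _
  obtain ⟨P, hP, ⟨φ⟩⟩ := huniv H hinf hsep hHκ
  -- At closure points of `g` the two filtrations agree, both in membership and in approximability
  -- modulo each `p ^ (n + 1)`.
  have hg : ∀ β, ∃ γ, (∀ y ∈ L β, r (φ y) < γ) ∧ ∀ y, r y ≤ β → ∀ n : ℕ,
      (∃ h, ∃ z, (φ h : G) - y = p ^ (n + 1) • z) →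
        ∃ h ∈ L γ, ∃ z, (φ h : G) - y = p ^ (n + 1) • z := by
    intro β
    obtain ⟨γ₁, h₁⟩ := exists_forall_lt_of_mk_lt hκ (fun y : L β => r (φ y)) (hLκ β)
    have hlev : ∀ w : {y // r y ≤ β} × ℕ, ∃ γ,
        (∃ h, ∃ z, (φ h : G) - w.1.1 = p ^ (w.2 + 1) • z) →
          ∃ h ∈ L γ, ∃ z, (φ h : G) - w.1.1 = p ^ (w.2 + 1) • z := by
      intro w
      by_cases hw : ∃ h, ∃ z, (φ h : G) - w.1.1 = p ^ (w.2 + 1) • z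
      · obtain ⟨h, hz⟩ := hw
        obtain ⟨γ, hγ⟩ := hLtop h
        exact ⟨γ, fun _ => ⟨h, hγ, hz⟩⟩
      · exact ⟨β, fun h => absurd h hw⟩
    choose l hl using hlev
    have hcard : #({y // r y ≤ β} × ℕ) < κ := by
      rw [mk_prod, lift_uzero, mk_nat, lift_aleph0]
      refine mul_lt_of_lt hκ.1 ?_ hκ0
      refine (mk_le_of_injective (f := fun y : {y // r y ≤ β} => (⟨r y.1, y.2⟩ : Set.Iic β))
        fun y y' h => ?_).trans_lt (mk_Iic_ord_toType_lt hκ.1 β)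
      exact Subtype.ext (r.injective (congrArg Subtype.val h))
    obtain ⟨γ₂, h₂⟩ := exists_forall_lt_of_mk_lt hκ l hcard
    refine ⟨max γ₁ γ₂, fun y hy => lt_max_of_lt_left (h₁ ⟨y, hy⟩), fun y hy n hh => ?_⟩
    obtain ⟨h, hhL, hz⟩ := hl (⟨y, hy⟩, n) hh
    exact ⟨h, hLmono ((h₂ _).le.trans (le_max_right _ _)) hhL, hz⟩
  choose g hgL hgr using hg
  obtain ⟨i, hi⟩ := hguess g
  refine hbr i (φ (x i)) fun n q => ⟨?_, fun hq => ?_⟩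
  · rintro ⟨y, hy, hz⟩
    obtain ⟨h, hhL, z', hz'⟩ := hgr (r y) y le_rfl n ⟨_, hz⟩
    obtain ⟨z, hz⟩ := hz
    by_contra hq
    -- If `q ≤ b i n`, then `h` approximates `x i` before the stage `c i (b i n)`; purity moves this
    -- into `H`, against `hxL'`.
    have hlt : g (r y) < c i (b i n) := (hi q _ hy).trans_le ((hc i).monotone (not_lt.1 hq))
    have hdiv : ((φ (x i - h) : P) : G) = p ^ (n + 1) • (z - z') := by
      rw [smul_sub, ← hz, ← hz', map_sub, AddSubgroup.coe_sub]
      abel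
    obtain ⟨w, hw, hwe⟩ := hP.exists_mem_nsmul_eq (φ (x i - h)).2 hdiv
    refine hxL' i n _ hlt h hhL (φ.symm ⟨w, hw⟩) (φ.injective (Subtype.ext ?_))
    rw [hwe, map_nsmul, φ.apply_symm_apply]
    rfl
  · obtain ⟨y, hy, z, hz⟩ := hxL i n
    refine ⟨φ y, (hgL _ y hy).trans (hi q _ (hc i hq)), φ z, ?_⟩
    rw [← AddSubgroup.coe_sub, ← map_sub, hz, map_nsmul]
    rfl
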